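/- Let $A$ be a nonempty countable set of visible actions, $\tau\notin A$, and $A_\tau=A\cup\{\tau\}$. The terms of $\mathrm{BCCS}(A)$ over a countably infinite set of variables are built from variables, the constant $\mathbf 0$, binary choice $t+u$, and prefixing $\alpha t$ with $\alpha\in A_\tau$. The transitions between terms are given by the rules $\alpha t\xrightarrow{\alpha}t$, and: if $t\xrightarrow{\alpha}t'$ then $t+u\xrightarrow{\alpha}t'$ and $u+t\xrightarrow{\alpha}t'$ (variables have no transitions). Write $\Rightarrow$ for the reflexive-transitive closure of $\xrightarrow{\tau}$ and $\mathcal I(s)=\{\alpha\in A_\tau\mid \exists s':\ s\xrightarrow{\alpha}s'\}$. A pair $(a_1\cdots a_k,B)$ with $k\ge 0$, $a_1,\dots,a_k\in A$ and $B\subseteq A$ is a weak failure pair of $s$ if $s\Rightarrow\xrightarrow{a_1}\Rightarrow\cdots\Rightarrow\xrightarrow{a_k}\Rightarrow s'$ for some $s'$ with $\mathcal I(s')\subseteq A\setminus B$ (so $s'$ has no $\tau$-transition). Write $p\precsim_{\rm WF}q$ if every weak failure pair of $p$ is a weak failure pair of $q$, and $\tau\in\mathcal I(p)$ implies $\tau\in\mathcal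 I(q)$. Weak failures equivalence is $p\simeq_{\rm WF}q\iff p\precsim_{\rm WF}q$ and $q\precsim_{\rm WF}p$. For a set $E$ of equations between terms, $E\vdash t\approx u$ means that $t\approx u$ is derivable from substitution instances of equations in $E$ by reflexivity, symmetry, transitivity, and closure under prefixing and choice. $E$ is *sound* if $E\vdash t\approx u$ implies $\rho(t)\simeq_{\rm WF}\rho(u)$ for all closed substitutions $\rho$; *ground-complete* if $p\simeq_{\rm WF}q$ implies $E\vdash p\approx q$ for all closed terms $p,q$; and *$\omega$-complete* if, for all terms $t,u$, whenever $E\vdash\rho(t)\approx\rho(u)$ for all closed substitutions $\rho$, also $E\vdash t\approx u$. Let $E$ consist of the following equations, where $\alpha$ ranges over $A_\tau$ and $a$ over $A$: $$\begin{array}{ll} \text{A1} & x+y\approx y+x\\ \text{A2} & (x+y)+z\approx x+(y+z)\\ \text{A3} & x+x\approx x\\ \text{A4} & x+\mathbf 0\approx x\\ \text{WIF1} & \alpha(\tau x+\tau y)\approx \alpha x+\alpha y\\ \text{WIF2} & \tau x+y\approx\tau x+\tau(x+y)\\ \text{WFE} & ax+\tau(ay+z)\approx\tau(ax+ay+z).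 \end{array}$$ **Theorem.** 1. $E$ is sound and ground-complete for $\mathrm{BCCS}(A)$ modulo $\simeq_{\rm WF}$. 2. If $A$ is infinite, then $E$ is $\omega$-complete. 3. If $A$ is finite, then $E$ together with the equation $$\text{FE3}'\qquad \tau\Big(x+\sum_{b\in A}bz_b\Big)+\tau\Big(x+y+\sum_{b\in A}bz_b\Big)\approx\tau\Big(x+y+\sum_{b\in A}bz_b\Big)$$ (with $x$, $y$ and the $z_b$ pairwise distinct variables) is sound, ground-complete and $\omega$-complete for $\mathrm{BCCS}(A)$ modulo $\simeq_{\rm WF}$. -/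

import Mathlib

namespace BCCS

/-- The set `A ∪ {τ}` of actions: the visible actions `a ∈ A` and the hidden action `τ`. -/
inductive Act (A : Type*) where
  | tau : Act A
  | vis : A → Act A

/-- A labeled transition system with states `S` and labels in `A ∪ {τ}`. -/
structure LTS (S A : Type*) where
  /-- `Tr s α s'` is the transition from `s` to `s'` labeled `α`. -/
  Tr : S → Act A → S → Prop

namespace LTS

variable {S A : Type*} (L : LTS S A)

/-- `s ⇒ s'`: the reflexive-transitive closure of the `τ`-transitions. -/
def TauStar (s s' : S) : Prop :=
  Relation.ReflTransGen (fun p q => L.Tr p Act.tau q) s s'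

/-- `s` can perform an `α`-transition. -/
def Can (s : S) (α : Act A) : Prop := ∃ s', L.Tr s α s'

/-- The set of initial actions (`τ` included) of `s`. -/
def initials (s : S) : Set (Act A) := {α | L.Can s α}

/-- `s ⇒ -a₁→ ⇒ ⋯ ⇒ -aₖ→ ⇒ s'` for the word `a₁ ⋯ aₖ`. -/
def WeakTr : List A → S → S → Prop
  | [], s, s' => L.TauStar s s'
  | a :: w, s, s' => ∃ s₁ s₂, L.TauStar s s₁ ∧ L.Tr s₁ (Act.vis a) s₂ ∧ WeakTr w s₂ s'

/-- `(w, B)` is a weak failure pair of `s`: some `s'` is reached by the weak trace `w`, and the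
initial actions of `s'` lie in `A \ B` (so that, in particular, `s'` has no `τ`-transition). -/
def WeakFailure (s : S) (w : List A) (B : Set A) : Prop :=
  ∃ s', L.WeakTr w s s' ∧ L.initials s' ⊆ Act.vis '' Bᶜ

/-- The weak failures preorder. -/
def WFPreorder (s₁ s₂ : S) : Prop :=
  (∀ w B, L.WeakFailure s₁ w B → L.WeakFailure s₂ w B) ∧ (L.Can s₁ Act.tau → L.Can s₂ Act.tau)

/-- Weak failures equivalence: the kernel of the weak failures preorder. -/
def WFEquiv (s₁ s₂ : S) : Prop := L.WFPreorder s₁ s₂ ∧ L.WFPreorder s₂ s₁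

end LTS

/-- (Open) BCCS(A) terms; the countably infinite set of variables is `ℕ`. -/
inductive Term (A : Type*) where
  | var : ℕ → Term A
  | nil : Term A
  | add : Term A → Term A → Term A
  | pre : Act A → Term A → Term A

/-- Choice. -/
infixl:65 " ∔ " => Term.add
/-- Action prefix. -/
infixr:75 " ⬝ " => Term.pre

namespace Term

variable {A : Type*}

/-- The set of variables that occur in a term. -/
def vars : Term A → Set ℕ
  | var n => {n}
  | nil => ∅
  | add t u => vars t ∪ vars u
  | pre _ t => vars t

/-- Closed terms. -/
def IsClosed (t : Term A) : Prop := t.vars = ∅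

/-- Substitution of terms for variables. -/
def subst (σ : ℕ → Term A) : Term A → Term A
  | var n => σ n
  | nil => nil
  | add t u => add (subst σ t) (subst σ u)
  | pre α t => pre α (subst σ t)

/-- The sum `t₁ + ⋯ + tₙ` of a list of terms; the empty sum is `nil`. -/
def sum : List (Term A) → Term A
  | [] => nil
  | t :: l => add t (sum l)

end Term

/-- Closed substitutions map every variable to a closed term. -/
def ClosedSubst {A : Type*} (ρ : ℕ → Term A) : Prop := ∀ n, (ρ n).IsClosed

/-- The transition rules. Variables have no transitions. -/
inductive Step {A : Type*} : Term A → Act A → Term A → Prop where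
  | pre (α : Act A) (t : Term A) : Step (α ⬝ t) α t
  | addLeft {t t' : Term A} {α : Act A} (u : Term A) : Step t α t' → Step (t ∔ u) α t'
  | addRight {u u' : Term A} {α : Act A} (t : Term A) : Step u α u' → Step (t ∔ u) α u'

/-- The labeled transition system whose states are the BCCS(A) terms. -/
def termLTS (A : Type*) : LTS (Term A) A := ⟨Step⟩

/-- Weak failures equivalence of terms, with terms regarded as states of `termLTS A`. It is only
applied to closed terms below. -/
def WF {A : Type*} (p q : Term A) : Prop := (termLTS A).WFEquiv p q

/-- An equational axiomatization: a set of equations `t ≈ u`, written as pairs `(t, u)`. -/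
abbrev Axiomatization (A : Type*) := Set (Term A × Term A)

/-- `E ⊢ t ≈ u`: derivability from substitution instances of the equations in `E` by the rules of
equational logic. -/
inductive Derives {A : Type*} (E : Axiomatization A) : Term A → Term A → Prop where
  | ax {t u : Term A} (σ : ℕ → Term A) : (t, u) ∈ E → Derives E (t.subst σ) (u.subst σ)
  | refl (t : Term A) : Derives E t t
  | symm {t u : Term A} : Derives E t u → Derives E u t
  | trans {t u v : Term A} : Derives E t u → Derives E u v → Derives E t v
  | pre (α : Act A) {t u : Term A} : Derives E t u → Derives E (α ⬝ t) (α ⬝ u)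
  | add {t₁ u₁ t₂ u₂ : Term A} :
      Derives E t₁ u₁ → Derives E t₂ u₂ → Derives E (t₁ ∔ t₂) (u₁ ∔ u₂)

/-- `E` is sound modulo the relation `R` on closed terms. -/
def Sound {A : Type*} (E : Axiomatization A) (R : Term A → Term A → Prop) : Prop :=
  ∀ t u, Derives E t u → ∀ ρ, ClosedSubst ρ → R (t.subst ρ) (u.subst ρ)

/-- `E` is ground-complete modulo the relation `R` on closed terms. -/
def GroundComplete {A : Type*} (E : Axiomatization A) (R : Term A → Term A → Prop) : Prop :=
  ∀ p q : Term A, p.IsClosed → q.IsClosed → R p q → Derives E p q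

/-- `E` is ω-complete. -/
def OmegaComplete {A : Type*} (E : Axiomatization A) : Prop :=
  ∀ t u : Term A, (∀ ρ, ClosedSubst ρ → Derives E (t.subst ρ) (u.subst ρ)) → Derives E t u

section Axioms

variable (A : Type*)

/-- The variable `x`. -/
def x : Term A := Term.var 0
/-- The variable `y`. -/
def y : Term A := Term.var 1
/-- The variable `z`. -/
def z : Term A := Term.var 2

/-- The axioms A1-4. -/
def A14 : Axiomatization A :=
  {(x A ∔ y A, y A ∔ x A),
   ((x A ∔ y A) ∔ z A, x A ∔ (y A ∔ z A)),
   (x A ∔ x A, x A),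
   (x A ∔ Term.nil, x A)}

/-- WIF1: `α(τx + τy) ≈ αx + αy`, one equation for every `α ∈ A ∪ {τ}`. -/
def WIF1 : Axiomatization A :=
  {e | ∃ α : Act A, e = (α ⬝ (Act.tau ⬝ x A ∔ Act.tau ⬝ y A), α ⬝ x A ∔ α ⬝ y A)}

/-- WIF2: `τx + y ≈ τx + τ(x + y)`. -/
def WIF2 : Axiomatization A :=
  {(Act.tau ⬝ x A ∔ y A, Act.tau ⬝ x A ∔ Act.tau ⬝ (x A ∔ y A))}

/-- WFE: `ax + τ(ay + z) ≈ τ(ax + ay + z)`, one equation for every `a ∈ A`. -/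
def WFE : Axiomatization A :=
  {e | ∃ a : A, e = (Act.vis a ⬝ x A ∔ Act.tau ⬝ (Act.vis a ⬝ y A ∔ z A),
    Act.tau ⬝ (Act.vis a ⬝ x A ∔ Act.vis a ⬝ y A ∔ z A))}

/-- `∑_{b ∈ A} b z_b` for a finite alphabet `A`, where the `z_b` are pairwise distinct variables,
different from `x` and `y`. -/
noncomputable def sumPre [Fintype A] : Term A :=
  Term.sum ((Finset.univ : Finset A).toList.map
    fun b => Act.vis b ⬝ Term.var (2 + (Fintype.equivFin A b : ℕ)))

/-- FE3': `τ(x + ∑ b z_b) + τ(x + y + ∑ b z_b) ≈ τ(x + y + ∑ b z_b)`. -/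
noncomputable def FE3' [Fintype A] : Axiomatization A :=
  {(Act.tau ⬝ (x A ∔ sumPre A) ∔ Act.tau ⬝ (x A ∔ y A ∔ sumPre A),
    Act.tau ⬝ (x A ∔ y A ∔ sumPre A))}

/-- The axiomatization A1-4 + WIF1-2 + WFE. -/
def axWFE : Axiomatization A := A14 A ∪ WIF1 A ∪ WIF2 A ∪ WFE A

end Axioms

end BCCS

namespace BCCS

open LTS Term

variable {A : Type*}

/-! ### Transitions of terms -/

/-! Soundness is compositional: the weak failures and the initial `τ` of a choice or a prefix are
determined by those of its components, so `WF` is a congruence, and each axiom becomes a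
propositional check.

Completeness rests on `derives_of_forall_wf`. Substituting powers `bᵐ 0` for variables turns
equivalence of all closed instances into `Sim`, which compares the variables and stable states
reached by each weak trace. Modulo A1-4, terms form a semilattice ordered by absorption. There WIF1
and WIF2 bring every term to a form that is either free of `τ` or a nonempty sum of `τ`-prefixed
`τ`-free terms. The core is `Sim.tau_le`: if `t` is `τ`-free and `Sim t u` holds, then `τu` absorbs
`τt`. By induction on size, `τu` absorbs every summand of `t`; then WFE, applied to a stable state
of `u` that refines `t`, yields `τt` itself.

No such state need exist when `t` offers every visible action, since then no action is left whose
refusal detects a variable. That case is the hypothesis `AbsorbsFull`: vacuous for infinite `A`, as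
a term has finitely many initial actions, and supplied by FE3' for finite `A`. Closed instances of
FE3' follow from the other axioms, so FE3' is sound and can be eliminated from proofs of closed
equations. -/

@[simp] lemma not_step_var (n : ℕ) (α : Act A) (t : Term A) : ¬ Step (.var n) α t := nofun

@[simp] lemma not_step_nil (α : Act A) (t : Term A) : ¬ Step .nil α t := nofun

@[simp] lemma step_pre_iff {α β : Act A} {t t' : Term A} :
    Step (α ⬝ t) β t' ↔ α = β ∧ t = t' := by
  constructor
  · rintro ⟨⟩
    exact ⟨rfl, rfl⟩
  · rintro ⟨rfl, rfl⟩
    exact .pre _ _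

@[simp] lemma step_add_iff {α : Act A} {t u t' : Term A} :
    Step (t ∔ u) α t' ↔ Step t α t' ∨ Step u α t' := by
  constructor
  · rintro (_ | ⟨_, h⟩ | ⟨_, h⟩)
    · exact .inl h
    · exact .inr h
  · rintro (h | h)
    · exact .addLeft _ h
    · exact .addRight _ h

/-- `t` has an `α`-transition. -/
abbrev Can (t : Term A) (α : Act A) : Prop := (termLTS A).Can t α

/-- Weak transitions of terms. -/
abbrev WeakTr (w : List A) (t t' : Term A) : Prop := (termLTS A).WeakTr w t t'

/-- Weak failure pairs of terms. -/
abbrev WeakFailure (t : Term A) (w : List A) (B : Set A) : Prop := (termLTS A).WeakFailure t w B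

lemma can_def {t : Term A} {α : Act A} : Can t α ↔ ∃ t', Step t α t' := Iff.rfl

@[simp] lemma not_can_nil (α : Act A) : ¬ Can (Term.nil : Term A) α := by simp [can_def]

@[simp] lemma can_pre_iff {α β : Act A} {t : Term A} : Can (α ⬝ t) β ↔ α = β := by
  simp [can_def]

@[simp] lemma can_add_iff {α : Act A} {t u : Term A} :
    Can (t ∔ u) α ↔ Can t α ∨ Can u α := by
  simp [can_def, exists_or]

/-- The variable `n` is a summand of the term. -/
def Head (n : ℕ) : Term A → Prop
  | .var m => m = n
  | .nil => False
  | .add t u => Head n t ∨ Head n u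
  | .pre _ _ => False

lemma weakTr_nil_refl (t : Term A) : WeakTr [] t t := Relation.ReflTransGen.refl

lemma WeakTr.head_tau {w : List A} {t t' s : Term A} (h : Step t .tau t') (h' : WeakTr w t' s) :
    WeakTr w t s := by
  cases w with
  | nil => exact Relation.ReflTransGen.head h h'
  | cons a w =>
    obtain ⟨s₁, s₂, h₁, h₂, h₃⟩ := h'
    exact ⟨s₁, s₂, Relation.ReflTransGen.head h h₁, h₂, h₃⟩

lemma WeakTr.head_vis {w : List A} {a : A} {t t' s : Term A} (h : Step t (.vis a) t')
    (h' : WeakTr w t' s) : WeakTr (a :: w) t s :=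
  ⟨t, t', Relation.ReflTransGen.refl, h, h'⟩

/-- Induction over weak transitions, one transition at a time. -/
lemma WeakTr.induction {s : Term A} {P : List A → Term A → Prop} (refl : P [] s)
    (tau : ∀ w t t', Step t .tau t' → WeakTr w t' s → P w t' → P w t)
    (vis : ∀ a w t t', Step t (.vis a) t' → WeakTr w t' s → P w t' → P (a :: w) t)
    {w : List A} {t : Term A} (h : WeakTr w t s) : P w t := by
  induction w generalizing t with
  | nil =>
    induction h using Relation.ReflTransGen.head_induction_on with
    | refl => exact refl
    | head h h' ih => exact tau _ _ _ h h' ih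
  | cons a w ih =>
    obtain ⟨s₁, s₂, h₁, h₂, h₃⟩ := h
    induction h₁ using Relation.ReflTransGen.head_induction_on with
    | refl => exact vis _ _ _ _ h₂ h₃ (ih h₃)
    | head h h' ih' => exact tau _ _ _ h ⟨s₁, s₂, h', h₂, h₃⟩ ih'

lemma WeakTr.append {v w : List A} {t s r : Term A} (h : WeakTr v t s) (h' : WeakTr w s r) :
    WeakTr (v ++ w) t r := by
  refine WeakTr.induction (P := fun v t => WeakTr (v ++ w) t r) h' ?_ ?_ h
  · exact fun _ _ _ h _ ih => ih.head_tau h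
  · exact fun _ _ _ _ h _ ih => ih.head_vis h

/-- The possible first transitions of a weak transition. -/
lemma weakTr_cases {w : List A} {t s : Term A} (h : WeakTr w t s) :
    (w = [] ∧ t = s) ∨ (∃ t', Step t .tau t' ∧ WeakTr w t' s) ∨
      ∃ a v t', w = a :: v ∧ Step t (.vis a) t' ∧ WeakTr v t' s := by
  refine WeakTr.induction (P := fun w t => (w = [] ∧ t = s) ∨
      (∃ t', Step t .tau t' ∧ WeakTr w t' s) ∨
      ∃ a v t', w = a :: v ∧ Step t (.vis a) t' ∧ WeakTr v t' s) (.inl ⟨rfl, rfl⟩) ?_ ?_ h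
  · exact fun w t t' h h' _ => .inr (.inl ⟨t', h, h'⟩)
  · exact fun a w t t' h h' _ => .inr (.inr ⟨a, w, t', rfl, h, h'⟩)

lemma Step.sizeOf_lt {t t' : Term A} {α : Act A} (h : Step t α t') : sizeOf t' < sizeOf t := by
  induction h <;> simp <;> omega

lemma WeakTr.length_le {w : List A} {t s : Term A} (h : WeakTr w t s) :
    w.length + sizeOf s ≤ sizeOf t := by
  refine WeakTr.induction (P := fun w t => w.length + sizeOf s ≤ sizeOf t) (by simp) ?_ ?_ h
  · intro w t t' h _ ih
    have := h.sizeOf_lt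
    omega
  · intro a w t t' h _ ih
    have := h.sizeOf_lt
    simp only [List.length_cons]
    omega

/-! ### A compositional description of weak failures -/

lemma initials_subset_iff {t : Term A} {B : Set A} :
    (termLTS A).initials t ⊆ Act.vis '' Bᶜ ↔
      ¬ Can t .tau ∧ ∀ b ∈ B, ¬ Can t (.vis b) := by
  constructor
  · intro h
    refine ⟨fun hc => ?_, fun b hb hc => ?_⟩
    · obtain ⟨b, -, hb⟩ := h hc
      cases hb
    · obtain ⟨b', hb', h'⟩ := h hc
      cases h'
      exact hb' hb
  · rintro ⟨h₁, h₂⟩ (_ | b) hc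
    · exact (h₁ hc).elim
    · exact ⟨b, fun hb => h₂ b hb hc, rfl⟩

lemma weakFailure_nil_iff {t : Term A} {B : Set A} :
    WeakFailure t [] B ↔ (∃ t', Step t .tau t' ∧ WeakFailure t' [] B) ∨
      (¬ Can t .tau ∧ ∀ b ∈ B, ¬ Can t (.vis b)) := by
  rw [← initials_subset_iff]
  constructor
  · rintro ⟨s, h, hs⟩
    obtain ⟨-, rfl⟩ | ⟨t', ht, h'⟩ | ⟨a, v, t', h', -⟩ := weakTr_cases h
    · exact .inr hs
    · exact .inl ⟨t', ht, s, h', hs⟩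
    · cases h'
  · rintro (⟨t', ht, s, h, hs⟩ | hs)
    · exact ⟨s, WeakTr.head_tau ht h, hs⟩
    · exact ⟨t, weakTr_nil_refl t, hs⟩

lemma weakFailure_cons_iff {t : Term A} {a : A} {w : List A} {B : Set A} :
    WeakFailure t (a :: w) B ↔ (∃ t', Step t .tau t' ∧ WeakFailure t' (a :: w) B) ∨
      ∃ t', Step t (.vis a) t' ∧ WeakFailure t' w B := by
  constructor
  · rintro ⟨s, h, hs⟩
    obtain ⟨h', -⟩ | ⟨t', ht, h'⟩ | ⟨a, v, t', h', ht, h''⟩ := weakTr_cases h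
    · cases h'
    · exact .inl ⟨t', ht, s, h', hs⟩
    · cases h'
      exact .inr ⟨t', ht, s, h'', hs⟩
  · rintro (⟨t', ht, s, h, hs⟩ | ⟨t', ht, s, h, hs⟩)
    · exact ⟨s, WeakTr.head_tau ht h, hs⟩
    · exact ⟨s, WeakTr.head_vis ht h, hs⟩

lemma weakFailure_tau {t : Term A} {w : List A} {B : Set A} :
    WeakFailure (.tau ⬝ t) w B ↔ WeakFailure t w B := by
  cases w with
  | nil => rw [weakFailure_nil_iff]; simp
  | cons a w => rw [weakFailure_cons_iff]; simp

lemma weakFailure_vis_nil {a : A} {t : Term A} {B : Set A} :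
    WeakFailure (.vis a ⬝ t) [] B ↔ a ∉ B := by
  rw [weakFailure_nil_iff]
  simp only [step_pre_iff, can_pre_iff, reduceCtorEq, false_and, exists_false, not_false_eq_true,
    true_and, false_or, Act.vis.injEq]
  exact ⟨fun h hb => h a hb rfl, fun h b hb hab => h (hab ▸ hb)⟩

lemma weakFailure_vis_cons {a b : A} {t : Term A} {w : List A} {B : Set A} :
    WeakFailure (.vis a ⬝ t) (b :: w) B ↔ a = b ∧ WeakFailure t w B := by
  rw [weakFailure_cons_iff]
  simp

/-- Either a `τ`-step resolves the choice, and one summand alone decides, or the sum is itself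
stable, and then both summands must refuse `B`. -/
lemma weakFailure_add_nil {t u : Term A} {B : Set A} :
    WeakFailure (t ∔ u) [] B ↔ (Can t .tau ∧ WeakFailure t [] B) ∨
      (Can u .tau ∧ WeakFailure u [] B) ∨
      (¬ Can t .tau ∧ ¬ Can u .tau ∧ WeakFailure t [] B ∧ WeakFailure u [] B) := by
  rw [weakFailure_nil_iff, weakFailure_nil_iff (t := t), weakFailure_nil_iff (t := u)]
  have key : ∀ s : Term A, (∃ t', Step s .tau t' ∧ WeakFailure t' [] B) → Can s .tau :=
    fun s ⟨t', h, _⟩ => ⟨t', h⟩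
  have ht := key t
  have hu := key u
  simp only [step_add_iff, or_and_right, exists_or, can_add_iff, not_or, forall_and]
  generalize (∃ t', Step t .tau t' ∧ WeakFailure t' [] B) = P at *
  generalize (∃ t', Step u .tau t' ∧ WeakFailure t' [] B) = Q at *
  generalize (∀ b ∈ B, ¬ Can t (.vis b)) = R
  generalize (∀ b ∈ B, ¬ Can u (.vis b)) = S
  tauto

lemma weakFailure_add_cons {t u : Term A} {a : A} {w : List A} {B : Set A} :
    WeakFailure (t ∔ u) (a :: w) B ↔ WeakFailure t (a :: w) B ∨ WeakFailure u (a :: w) B := by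
  rw [weakFailure_cons_iff, weakFailure_cons_iff (t := t), weakFailure_cons_iff (t := u)]
  simp only [step_add_iff, or_and_right, exists_or]
  exact or_or_or_comm

lemma weakFailure_zero_nil {B : Set A} : WeakFailure .nil [] B := by
  rw [weakFailure_nil_iff]
  simp

lemma weakFailure_zero_cons {a : A} {w : List A} {B : Set A} :
    ¬ WeakFailure .nil (a :: w) B := by
  rw [weakFailure_cons_iff]
  simp

lemma wf_iff {p q : Term A} :
    WF p q ↔ (∀ w B, WeakFailure p w B ↔ WeakFailure q w B) ∧ (Can p .tau ↔ Can q .tau) :=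
  ⟨fun h => ⟨fun w B => ⟨h.1.1 w B, h.2.1 w B⟩, h.1.2, h.2.2⟩,
    fun h => ⟨⟨fun w B => (h.1 w B).1, h.2.1⟩, fun w B => (h.1 w B).2, h.2.2⟩⟩

lemma wf_iff' {p q : Term A} :
    WF p q ↔ (∀ B, WeakFailure p [] B ↔ WeakFailure q [] B) ∧
      (∀ a w B, WeakFailure p (a :: w) B ↔ WeakFailure q (a :: w) B) ∧
      (Can p .tau ↔ Can q .tau) := by
  rw [wf_iff]
  constructor
  · exact fun h => ⟨fun B => h.1 [] B, fun a w B => h.1 (a :: w) B, h.2⟩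
  · refine fun h => ⟨fun w B => ?_, h.2.2⟩
    cases w
    · exact h.1 B
    · exact h.2.1 _ _ B

lemma WF.pre {p q : Term A} (h : WF p q) (α : Act A) : WF (α ⬝ p) (α ⬝ q) := by
  rw [wf_iff] at h
  cases α
  · rw [wf_iff]
    simp [weakFailure_tau, h.1]
  · rw [wf_iff']
    simp [weakFailure_vis_nil, weakFailure_vis_cons, h.1]

/-- Whether a summand can do `τ` affects the failures of the sum after the empty trace; the
`τ`-clause of `WF` is what makes choice preserve it. -/
lemma WF.add {p q p' q' : Term A} (h : WF p q) (h' : WF p' q') : WF (p ∔ p') (q ∔ q') := by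
  rw [wf_iff] at h h'
  rw [wf_iff']
  simp [weakFailure_add_nil, weakFailure_add_cons, h.1, h.2, h'.1, h'.2]

lemma wf_wif1 (α : Act A) (p q : Term A) :
    WF (α ⬝ (.tau ⬝ p ∔ .tau ⬝ q)) (α ⬝ p ∔ α ⬝ q) := by
  rw [wf_iff']
  cases α <;> refine ⟨fun B => ?_, fun a w B => ?_, ?_⟩
  · simp [weakFailure_tau, weakFailure_add_nil]
  · simp [weakFailure_tau, weakFailure_add_cons]
  · simp
  · simp [weakFailure_vis_nil, weakFailure_add_nil]
  · cases w
    · simp only [weakFailure_vis_cons, weakFailure_add_cons, weakFailure_add_nil, weakFailure_tau,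
        can_pre_iff]
      tauto
    · simp only [weakFailure_vis_cons, weakFailure_add_cons, weakFailure_tau]
      tauto
  · simp

lemma wf_wif2 (p q : Term A) :
    WF (.tau ⬝ p ∔ q) (.tau ⬝ p ∔ .tau ⬝ (p ∔ q)) := by
  rw [wf_iff']
  refine ⟨fun B => ?_, fun a w B => ?_, ?_⟩
  · simp only [weakFailure_tau, weakFailure_add_nil, can_pre_iff]
    tauto
  · simp only [weakFailure_tau, weakFailure_add_cons]
    tauto
  · simp

lemma wf_wfe (a : A) (p q r : Term A) :
    WF (.vis a ⬝ p ∔ .tau ⬝ (.vis a ⬝ q ∔ r)) (.tau ⬝ (.vis a ⬝ p ∔ .vis a ⬝ q ∔ r)) := by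
  rw [wf_iff']
  refine ⟨fun B => ?_, fun a w B => ?_, ?_⟩
  · simp only [weakFailure_tau, weakFailure_add_nil, weakFailure_vis_nil, can_pre_iff, can_add_iff,
      reduceCtorEq]
    tauto
  · simp only [weakFailure_tau, weakFailure_add_cons, weakFailure_vis_cons]
    tauto
  · simp

/-- Every substitution instance of a derivable equation is sound, whether closed or not. -/
lemma wf_of_derives {t u : Term A} (h : Derives (axWFE A) t u) (ρ : ℕ → Term A) :
    WF (t.subst ρ) (u.subst ρ) := by
  induction h with
  | @ax t u σ h =>
    obtain ((h | ⟨α, h⟩) | h) | ⟨a, h⟩ := h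
    · obtain h | h | h | h := h <;> cases h <;> rw [wf_iff'] <;>
        refine ⟨fun B => ?_, fun a w B => ?_, ?_⟩ <;>
        simp only [x, y, z, Term.subst, weakFailure_add_nil, weakFailure_add_cons, can_add_iff,
          weakFailure_zero_nil, weakFailure_zero_cons, not_can_nil] <;> tauto
    · cases h
      exact wf_wif1 _ _ _
    · cases h
      exact wf_wif2 _ _
    · cases h
      exact wf_wfe _ _ _ _
  | refl t => exact wf_iff.2 ⟨fun _ _ => Iff.rfl, Iff.rfl⟩
  | symm _ ih => exact ⟨ih.2, ih.1⟩
  | trans _ _ ih₁ ih₂ =>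
    rw [wf_iff] at *
    exact ⟨fun w B => (ih₁.1 w B).trans (ih₂.1 w B), ih₁.2.trans ih₂.2⟩
  | pre α _ ih => exact ih.pre α
  | add _ _ ih₁ ih₂ => exact ih₁.add ih₂

/-! ### Transitions of substitution instances -/

lemma Step.subst {t t' : Term A} {α : Act A} (h : Step t α t') (ρ : ℕ → Term A) :
    Step (t.subst ρ) α (t'.subst ρ) := by
  induction h with
  | pre α t => exact .pre _ _
  | addLeft _ _ ih => exact .addLeft _ ih
  | addRight _ _ ih => exact .addRight _ ih

lemma Head.step_subst {n : ℕ} {t t' : Term A} {α : Act A} {ρ : ℕ → Term A} (hn : Head n t)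
    (h : Step (ρ n) α t') : Step (t.subst ρ) α t' := by
  induction t with
  | var m => cases hn; exact h
  | nil => cases hn
  | add t u iht ihu => exact hn.elim (fun hn => .addLeft _ (iht hn)) fun hn => .addRight _ (ihu hn)
  | pre β t => cases hn

lemma step_subst_cases {t s : Term A} {α : Act A} {ρ : ℕ → Term A} (h : Step (t.subst ρ) α s) :
    (∃ t', Step t α t' ∧ s = t'.subst ρ) ∨ ∃ n, Head n t ∧ Step (ρ n) α s := by
  induction t with
  | var m => exact .inr ⟨m, rfl, h⟩
  | nil => cases h
  | add t u iht ihu =>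
    obtain h | h := step_add_iff.1 h
    · obtain ⟨t', h, hs⟩ | ⟨n, hn, h⟩ := iht h
      · exact .inl ⟨t', .addLeft _ h, hs⟩
      · exact .inr ⟨n, .inl hn, h⟩
    · obtain ⟨t', h, hs⟩ | ⟨n, hn, h⟩ := ihu h
      · exact .inl ⟨t', .addRight _ h, hs⟩
      · exact .inr ⟨n, .inr hn, h⟩
  | pre β t =>
    obtain ⟨rfl, rfl⟩ := step_pre_iff.1 h
    exact .inl ⟨t, .pre _ _, rfl⟩

lemma WeakTr.subst {w : List A} {t s : Term A} (h : WeakTr w t s) (ρ : ℕ → Term A) :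
    WeakTr w (t.subst ρ) (s.subst ρ) := by
  refine WeakTr.induction (P := fun w t => WeakTr w (t.subst ρ) (s.subst ρ))
    (weakTr_nil_refl _) ?_ ?_ h
  · exact fun _ _ _ h _ ih => ih.head_tau (h.subst ρ)
  · exact fun _ _ _ _ h _ ih => ih.head_vis (h.subst ρ)

/-- The term `aᵐ 0`. -/
def power (a : A) : ℕ → Term A
  | 0 => .nil
  | m + 1 => .vis a ⬝ power a m

lemma isClosed_power (a : A) (m : ℕ) : (power a m).IsClosed := by
  induction m with
  | zero => rfl
  | succ m ih => exact ih

lemma step_power {a : A} {m : ℕ} {α : Act A} {s : Term A} (h : Step (power a m) α s) :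
    ∃ k, m = k + 1 ∧ α = .vis a ∧ s = power a k := by
  cases m with
  | zero => cases h
  | succ m =>
    obtain ⟨rfl, rfl⟩ := step_pre_iff.1 h
    exact ⟨m, rfl, rfl, rfl⟩

lemma weakTr_power {a : A} {m : ℕ} {w : List A} {s : Term A} (h : WeakTr w (power a m) s) :
    ∃ j ≤ m, w = List.replicate j a ∧ s = power a (m - j) := by
  induction m generalizing w with
  | zero =>
    obtain ⟨rfl, rfl⟩ | ⟨t', ht, -⟩ | ⟨a, v, t', rfl, ht, -⟩ := weakTr_cases h
    · exact ⟨0, le_rfl, rfl, rfl⟩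
    all_goals cases ht
  | succ m ih =>
    obtain ⟨rfl, rfl⟩ | ⟨t', ht, -⟩ | ⟨b, v, t', rfl, ht, h'⟩ := weakTr_cases h
    · exact ⟨0, by omega, rfl, rfl⟩
    · cases ht
    · cases ht
      obtain ⟨j, hj, rfl, rfl⟩ := ih h'
      exact ⟨j + 1, by omega, rfl, by congr 1; omega⟩

lemma weakTr_power_nil (a : A) (m : ℕ) : WeakTr (List.replicate m a) (power a m) .nil := by
  induction m with
  | zero => exact weakTr_nil_refl _
  | succ m ih => exact ih.head_vis (.pre _ _)

/-- A weak transition of an instance under a substitution by terms `bᵐ 0` stays inside the term or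
enters one of the substituted terms. -/
lemma weakTr_subst_power_cases {b : A} {f : ℕ → ℕ} {w : List A} {t s : Term A}
    (h : WeakTr w (t.subst fun n => power b (f n)) s) :
    (∃ t', WeakTr w t t' ∧ s = t'.subst fun n => power b (f n)) ∨
      ∃ v t' n j, w = v ++ List.replicate (j + 1) b ∧ WeakTr v t t' ∧ Head n t' ∧ j + 1 ≤ f n ∧
        s = power b (f n - (j + 1)) := by
  generalize hr : t.subst (fun n => power b (f n)) = r at h
  revert hr
  refine WeakTr.induction (P := fun w r => ∀ t : Term A,
    t.subst (fun n => power b (f n)) = r →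
    (∃ t', WeakTr w t t' ∧ s = t'.subst fun n => power b (f n)) ∨
      ∃ v t' n j, w = v ++ List.replicate (j + 1) b ∧ WeakTr v t t' ∧ Head n t' ∧ j + 1 ≤ f n ∧
        s = power b (f n - (j + 1))) ?_ ?_ ?_ h t
  · rintro t rfl
    exact .inl ⟨t, weakTr_nil_refl _, rfl⟩
  · rintro w _ r' hs - ih t rfl
    obtain ⟨t', ht, rfl⟩ | ⟨n, hn, h'⟩ := step_subst_cases hs
    · obtain ⟨t'', h, hs⟩ | ⟨v, t'', n, j, hw, h, h'⟩ := ih t' rfl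
      · exact .inl ⟨t'', h.head_tau ht, hs⟩
      · exact .inr ⟨v, t'', n, j, hw, h.head_tau ht, h'⟩
    · obtain ⟨k, -, h, -⟩ := step_power h'
      cases h
  · rintro a w _ r' hs h ih t rfl
    obtain ⟨t', ht, rfl⟩ | ⟨n, hn, h'⟩ := step_subst_cases hs
    · obtain ⟨t'', h, hs⟩ | ⟨v, t'', n, j, rfl, h, h'⟩ := ih t' rfl
      · exact .inl ⟨t'', h.head_vis ht, hs⟩
      · exact .inr ⟨a :: v, t'', n, j, rfl, h.head_vis ht, h'⟩
    · obtain ⟨k, hk, hab, rfl⟩ := step_power h'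
      cases hab
      obtain ⟨j, hj, rfl, rfl⟩ := weakTr_power h
      exact .inr ⟨[], t, n, j, rfl, weakTr_nil_refl _, hn, by omega, by congr 1; omega⟩

/-! ### A preorder on open terms -/

/-- `s'` is stable and all its initial actions and head variables occur in `s`. -/
structure Refines (s' s : Term A) : Prop where
  stable : ¬ Can s' .tau
  can : ∀ a, Can s' (.vis a) → Can s (.vis a)
  head : ∀ n, Head n s' → Head n s

/-- The comparison of open terms by the variables and the stable states after each weak trace. -/
structure Sim (t u : Term A) : Prop where
  head : ∀ w n s, WeakTr w t s → Head n s → ∃ s', WeakTr w u s' ∧ Head n s'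
  stable : ∀ w s, WeakTr w t s → ¬ Can s .tau →
    ((∀ a, Can s (.vis a)) ∧ ∃ s', WeakTr w u s') ∨ ∃ s', WeakTr w u s' ∧ Refines s' s

lemma Sim.of_tau {t t' u : Term A} (h : Sim t u) (ht : Step t .tau t') : Sim t' u :=
  ⟨fun w n s hs => h.head w n s (hs.head_tau ht), fun w s hs => h.stable w s (hs.head_tau ht)⟩

/-- A power of an action marks a variable: it is made either too long to be matched by `u` itself,
or too long to be used up during `w`. -/
lemma sim_of_wfPreorder [Nonempty A] {t u : Term A}
    (h : ∀ ρ, ClosedSubst ρ → (termLTS A).WFPreorder (t.subst ρ) (u.subst ρ)) : Sim t u := by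
  classical
  constructor
  · intro w n s hw hn
    obtain ⟨a⟩ := ‹Nonempty A›
    -- No weak trace of `u` has length `m`, so the trace `w aᵐ` can only be matched by entering the
    -- copy of `aᵐ 0` at the variable `n`.
    set m := sizeOf u + 1 with hm
    let f : ℕ → ℕ := fun k => if k = n then m else 0
    have hf : f n = m := if_pos rfl
    have h₁ : WeakTr (List.replicate m a) (s.subst fun k => power a (f k)) .nil := by
      refine WeakTr.head_vis (w := List.replicate (sizeOf u) a) (a := a)
        (t' := power a (sizeOf u)) ?_ (weakTr_power_nil _ _)
      refine hn.step_subst ?_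
      simp only [hf, hm]
      exact .pre _ _
    obtain ⟨s', hs', hB⟩ := (h _ fun k => isClosed_power a (f k)).1 (w ++ List.replicate m a)
      Set.univ ⟨_, (hw.subst _).append h₁, initials_subset_iff.2 (by simp)⟩
    obtain ⟨t', ht', -⟩ | ⟨v, t', k, j, hv, ht', hk, hj, rfl⟩ := weakTr_subst_power_cases hs'
    · have := ht'.length_le
      simp only [List.length_append, List.length_replicate] at this
      omega
    · have hkn : k = n := by
        by_contra hkn
        simp [f, hkn] at hj
      subst hkn
      rw [hf] at hj hB
      -- The final state refuses `a`, so the whole power has been consumed and `n` was entered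
      -- exactly after `w`.
      have hmj : m = j + 1 := by
        by_contra hne
        obtain ⟨i, hi⟩ : ∃ i, m - (j + 1) = i + 1 := ⟨m - (j + 1) - 1, by omega⟩
        rw [hi] at hB
        exact (initials_subset_iff.1 hB).2 a trivial ⟨_, .pre _ _⟩
      have hwv : v = w := List.append_cancel_right (hv.symm.trans (by rw [hmj]))
      exact ⟨t', hwv ▸ ht', hk⟩
  · intro w s hw hs
    by_cases hall : ∀ a, Can s (.vis a)
    · refine .inl ⟨hall, ?_⟩
      obtain ⟨a⟩ := ‹Nonempty A›
      have hns : ¬ Can (s.subst fun _ => power a 0) .tau := by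
        rintro ⟨r, hr⟩
        obtain ⟨t', ht', -⟩ | ⟨n, -, hn⟩ := step_subst_cases hr
        · exact hs ⟨t', ht'⟩
        · cases hn
      obtain ⟨s', hs', -⟩ := (h _ fun k => isClosed_power a 0).1 w ∅
        ⟨_, hw.subst _, initials_subset_iff.2 ⟨hns, by simp⟩⟩
      · obtain ⟨t', ht', -⟩ | ⟨v, t', k, j, -, -, -, hj, -⟩ := weakTr_subst_power_cases
          (f := fun _ => 0) hs'
        · exact ⟨t', ht'⟩
        · omega
    · refine .inr ?_
      push Not at hall
      obtain ⟨b, hb⟩ := hall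
      -- Head variables of `s` become `0`, so its instance offers nothing beyond `s`. Any other
      -- variable offers `b`, even after all of `w`, and `b` is refused: it can neither be entered
      -- nor be a head of the matching state.
      let f : ℕ → ℕ := fun k => if Head k s then 0 else w.length + 1
      have hcan : ∀ α, Can (s.subst fun k => power b (f k)) α → Can s α := by
        rintro α ⟨r, hr⟩
        obtain ⟨t', ht', -⟩ | ⟨n, hn, hr⟩ := step_subst_cases hr
        · exact ⟨t', ht'⟩
        · simp only [f, hn, if_true] at hr
          cases hr
      obtain ⟨s', hs', hB⟩ := (h _ fun k => isClosed_power b (f k)).1 w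
        {a | ¬ Can s (.vis a)} ⟨_, hw.subst _, initials_subset_iff.2
          ⟨fun hc => hs (hcan _ hc), fun a ha hc => ha (hcan _ hc)⟩⟩
      obtain ⟨hB₁, hB₂⟩ := initials_subset_iff.1 hB
      obtain ⟨t', ht', rfl⟩ | ⟨v, t', k, j, hv, ht', hk, hj, rfl⟩ := weakTr_subst_power_cases hs'
      · refine ⟨t', ht', ?_, ?_, ?_⟩
        · exact fun ⟨r, hr⟩ => hB₁ ⟨_, hr.subst _⟩
        · rintro a ⟨r, hr⟩
          by_contra ha
          exact hB₂ a ha ⟨_, hr.subst _⟩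
        · intro n hn
          by_contra hns
          refine hB₂ b hb ⟨power b w.length, hn.step_subst ?_⟩
          simp only [f, hns, if_false]
          exact .pre _ _
      · have hlen : j + 1 ≤ w.length := by simp [hv]
        have hfk : f k = w.length + 1 := by
          by_cases hks : Head k s
          · simp [f, hks] at hj
          · simp [f, hks]
        obtain ⟨i, hi⟩ : ∃ i, f k - (j + 1) = i + 1 := ⟨f k - (j + 1) - 1, by omega⟩
        rw [hi] at hB₂
        exact (hB₂ b hb ⟨_, .pre _ _⟩).elim

/-! ### Finiteness of the reachable states -/

/-- The set of all subterms of a term. -/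
def subterms : Term A → Set (Term A)
  | .var n => {.var n}
  | .nil => {.nil}
  | .add t u => insert (t ∔ u) (subterms t ∪ subterms u)
  | .pre α t => insert (α ⬝ t) (subterms t)

lemma finite_subterms (t : Term A) : (subterms t).Finite := by
  induction t with
  | var n => exact Set.finite_singleton _
  | nil => exact Set.finite_singleton _
  | add t u iht ihu => exact (iht.union ihu).insert _
  | pre α t ih => exact ih.insert _

lemma self_mem_subterms (t : Term A) : t ∈ subterms t := by
  cases t <;> simp [subterms]

lemma Step.subterms_subset {t t' : Term A} {α : Act A} (h : Step t α t') :
    subterms t' ⊆ subterms t := by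
  induction h with
  | pre α t => exact Set.subset_insert _ _
  | addLeft u _ ih => exact (ih.trans Set.subset_union_left).trans (Set.subset_insert _ _)
  | addRight t _ ih => exact (ih.trans Set.subset_union_right).trans (Set.subset_insert _ _)

lemma WeakTr.subterms_subset {w : List A} {t s : Term A} (h : WeakTr w t s) :
    subterms s ⊆ subterms t :=
  WeakTr.induction (P := fun _ t => subterms s ⊆ subterms t) subset_rfl
    (fun _ _ _ h _ ih => ih.trans h.subterms_subset)
    (fun _ _ _ _ h _ ih => ih.trans h.subterms_subset) h

/-- Finiteness allows all weak `a`-derivatives to be gathered into one term, which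
`Sim.exists_derivative` uses. -/
lemma exists_list_weak_derivatives (u : Term A) (a : A) :
    ∃ l : List (Term A), ∀ u', u' ∈ l ↔ ∃ u₁, WeakTr [] u u₁ ∧ Step u₁ (.vis a) u' := by
  have hfin : {u' | ∃ u₁, WeakTr [] u u₁ ∧ Step u₁ (.vis a) u'}.Finite := by
    refine (finite_subterms u).subset ?_
    rintro u' ⟨u₁, h, h'⟩
    exact h.subterms_subset (h'.subterms_subset (self_mem_subterms u'))
  exact ⟨hfin.toFinset.toList, by simp⟩

lemma finite_can_vis (t : Term A) : {a | Can t (.vis a)}.Finite := by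
  induction t with
  | var n => simp [can_def]
  | nil => simp
  | add t u iht ihu => simpa [Set.ofPred_or] using iht.union ihu
  | pre α t ih =>
    cases α
    · simp
    · simp [Set.finite_singleton]

/-! ### Terms modulo derivability -/

lemma Derives.mono {E E' : Axiomatization A} (hE : E ⊆ E') {t u : Term A} (h : Derives E t u) :
    Derives E' t u := by
  induction h with
  | ax σ h => exact .ax σ (hE h)
  | refl t => exact .refl t
  | symm _ ih => exact ih.symm
  | trans _ _ ih₁ ih₂ => exact ih₁.trans ih₂
  | pre α _ ih => exact ih.pre α
  | add _ _ ih₁ ih₂ => exact ih₁.add ih₂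

/-- Derivability as a setoid. -/
def derivesSetoid (E : Axiomatization A) : Setoid (Term A) :=
  ⟨Derives E, .refl, .symm, .trans⟩

/-- Terms modulo derivability from `E`. -/
def TermQuot (E : Axiomatization A) : Type _ := Quotient (derivesSetoid E)

/-- The class of a term. -/
def cls (E : Axiomatization A) (t : Term A) : TermQuot E := Quotient.mk (derivesSetoid E) t

variable {E : Axiomatization A}

lemma cls_eq_iff {t u : Term A} : cls E t = cls E u ↔ Derives E t u :=
  Quotient.eq (r := derivesSetoid E)

lemma TermQuot.ind {P : TermQuot E → Prop} (h : ∀ t, P (cls E t)) (q : TermQuot E) : P q :=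
  Quotient.ind h q

/-- Choice on classes. -/
def TermQuot.add (p q : TermQuot E) : TermQuot E :=
  Quotient.map₂ (sa := derivesSetoid E) (sb := derivesSetoid E) (sc := derivesSetoid E)
    Term.add (fun _ _ h _ _ h' => Derives.add h h') p q

/-- Action prefix on classes. -/
def act (α : Act A) (p : TermQuot E) : TermQuot E :=
  Quotient.map (sa := derivesSetoid E) (sb := derivesSetoid E) (Term.pre α)
    (fun _ _ h => Derives.pre α h) p

lemma cls_pre (α : Act A) (t : Term A) : cls E (α ⬝ t) = act α (cls E t) := rfl

/-- The substitution that maps the first three variables to `t`, `u` and `v`. -/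
def subst₃ (t u v : Term A) : ℕ → Term A
  | 0 => t
  | 1 => u
  | _ => v

section Completeness

variable [hE : Fact (axWFE A ⊆ E)]

lemma derives_axiom {e : Term A × Term A} (he : e ∈ axWFE A) (t u v : Term A) :
    Derives E (e.1.subst (subst₃ t u v)) (e.2.subst (subst₃ t u v)) :=
  .ax _ (hE.out he)

/-- Modulo A1-4, terms form a semilattice whose order is absorption. -/
instance : SemilatticeSup (TermQuot E) :=
  @SemilatticeSup.mk' (TermQuot E) ⟨TermQuot.add⟩
    (by
      refine TermQuot.ind fun t => TermQuot.ind fun u => ?_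
      exact cls_eq_iff.2 (derives_axiom (E := E) (e := (x A ∔ y A, y A ∔ x A))
        (.inl (.inl (.inl (by simp [A14])))) t u u))
    (by
      refine TermQuot.ind fun t => TermQuot.ind fun u => TermQuot.ind fun v => ?_
      exact cls_eq_iff.2 (derives_axiom (E := E) (e := ((x A ∔ y A) ∔ z A, x A ∔ (y A ∔ z A)))
        (.inl (.inl (.inl (by simp [A14])))) t u v))
    (by
      refine TermQuot.ind fun t => ?_
      exact cls_eq_iff.2 (derives_axiom (E := E) (e := (x A ∔ x A, x A))
        (.inl (.inl (.inl (by simp [A14])))) t t t))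

lemma cls_add (t u : Term A) : cls E (t ∔ u) = cls E t ⊔ cls E u := rfl

lemma cls_le_add_left (t u : Term A) : cls E t ≤ cls E (t ∔ u) := le_sup_left (b := cls E u)

lemma cls_le_add_right (t u : Term A) : cls E u ≤ cls E (t ∔ u) := le_sup_right (a := cls E t)

instance : OrderBot (TermQuot E) where
  bot := cls E .nil
  bot_le := by
    refine TermQuot.ind fun t => ?_
    refine left_eq_sup.1 ?_ |>.trans le_rfl
    exact (cls_eq_iff.2 (derives_axiom (E := E) (e := (x A ∔ Term.nil, x A))
        (.inl (.inl (.inl (by simp [A14])))) t t t)).symm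

lemma cls_nil : cls E .nil = ⊥ := rfl

lemma act_tau_sup_tau (α : Act A) (p q : TermQuot E) :
    act α (act .tau p ⊔ act .tau q) = act α p ⊔ act α q := by
  induction p using TermQuot.ind with | _ t
  induction q using TermQuot.ind with | _ u
  exact cls_eq_iff.2 (derives_axiom (E := E) (.inl (.inl (.inr ⟨α, rfl⟩))) t u u)

lemma tau_sup (p q : TermQuot E) : act .tau p ⊔ q = act .tau p ⊔ act .tau (p ⊔ q) := by
  induction p using TermQuot.ind with | _ t
  induction q using TermQuot.ind with | _ u
  exact cls_eq_iff.2 (derives_axiom (E := E) (.inl (.inr rfl)) t u u)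

lemma vis_sup_tau (a : A) (p q r : TermQuot E) :
    act (.vis a) p ⊔ act .tau (act (.vis a) q ⊔ r) =
      act .tau (act (.vis a) p ⊔ act (.vis a) q ⊔ r) := by
  induction p using TermQuot.ind with | _ t
  induction q using TermQuot.ind with | _ u
  induction r using TermQuot.ind with | _ v
  exact cls_eq_iff.2 (derives_axiom (E := E) (.inr ⟨a, rfl⟩) t u v)

lemma act_tau (α : Act A) (p : TermQuot E) : act α (act .tau p) = act α p := by
  simpa using act_tau_sup_tau α p p

lemma le_tau (p : TermQuot E) : p ≤ act .tau p := by
  have := tau_sup p p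
  rw [sup_idem, sup_idem] at this
  exact sup_eq_left.1 this

/-- WIF2 gives `q = τp ⊔ τq`, and a `τ`-prefix on such a sum is removed by WIF1. -/
lemma tau_eq_self {p q : TermQuot E} (h : act .tau p ≤ q) : act .tau q = q := by
  have := tau_sup p q
  rw [sup_eq_right.2 h] at this
  rw [this, act_tau_sup_tau]

/-- The usable half of WIF2: `τp + q` absorbs `τ(p + q)`. -/
lemma tau_sup_le {p q r : TermQuot E} (hp : act .tau p ≤ r) (hq : q ≤ r) :
    act .tau (p ⊔ q) ≤ r :=
  le_sup_right.trans ((tau_sup p q).symm.le.trans (sup_le hp hq))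

/-- By WIF1, `αp + αq` is `α(τp + τq)`, where `τq` absorbs `τp`. -/
lemma act_le_act {p q : TermQuot E} (h : act .tau p ≤ act .tau q) (α : Act A) :
    act α p ≤ act α q := by
  rw [← sup_eq_right, ← act_tau_sup_tau, sup_eq_right.2 h, act_tau]

lemma Step.act_le {t t' : Term A} {α : Act A} (h : Step t α t') : act α (cls E t') ≤ cls E t := by
  induction h with
  | pre α t => exact le_rfl
  | addLeft u _ ih => exact ih.trans (cls_le_add_left _ _)
  | addRight t _ ih => exact ih.trans (cls_le_add_right _ _)

lemma Head.cls_le {n : ℕ} {t : Term A} (h : Head n t) : cls E (.var n) ≤ cls E t := by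
  induction t with
  | var m => cases h; exact le_rfl
  | nil => cases h
  | add t u iht ihu =>
    exact h.elim (fun h => (iht h).trans (cls_le_add_left _ _))
      fun h => (ihu h).trans (cls_le_add_right _ _)
  | pre β t => cases h

lemma tau_cls_eq_self {t : Term A} (h : Can t .tau) : act .tau (cls E t) = cls E t :=
  h.elim fun _ h => tau_eq_self h.act_le

/-- A class is above a term as soon as it is above all its summands. -/
lemma cls_le_of_summands {t : Term A} {q : TermQuot E}
    (hhead : ∀ n, Head n t → cls E (.var n) ≤ q)
    (hstep : ∀ α t', Step t α t' → act α (cls E t') ≤ q) : cls E t ≤ q := by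
  induction t with
  | var m => exact hhead m rfl
  | nil => exact bot_le
  | add t u iht ihu =>
    exact sup_le (iht (fun n hn => hhead n (.inl hn)) fun α t' h => hstep α t' (.addLeft _ h))
      (ihu (fun n hn => hhead n (.inr hn)) fun α t' h => hstep α t' (.addRight _ h))
  | pre β t => exact hstep β t (.pre _ _)

lemma tau_cls_le_of_weakTr {t s : Term A} (h : WeakTr [] t s) :
    act .tau (cls E s) ≤ act .tau (cls E t) :=
  Relation.ReflTransGen.head_induction_on h le_rfl fun h' _ ih =>
    ih.trans ((Step.act_le h').trans (le_tau _))

lemma cls_le_tau_of_weakTr {t s : Term A} (h : WeakTr [] t s) : cls E s ≤ act .tau (cls E t) :=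
  (le_tau _).trans (tau_cls_le_of_weakTr h)

/-- WIF1 distributes `α` over a sum of `τ`-prefixes. The list must be nonempty: for the empty sum
the claim would be that `q` absorbs `α0`. -/
lemma act_sum_tau_le {α : Act A} {q : TermQuot E} {l : List (Term A)} (hl : l ≠ [])
    (h : ∀ u ∈ l, act α (cls E u) ≤ q) :
    act α (cls E (Term.sum (l.map (Act.tau ⬝ ·)))) ≤ q := by
  induction l with
  | nil => exact (hl rfl).elim
  | cons u l ih =>
    simp only [List.map_cons, Term.sum, cls_add, cls_pre]
    have hu := h u (by simp)
    cases l with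
    | nil => simpa [Term.sum, cls_nil, act_tau] using hu
    | cons v l =>
      -- The nonempty tail can do `τ`, hence equals its own `τ`-prefix, which gives the left-hand
      -- side of WIF1.
      rw [← tau_cls_eq_self (t := Term.sum ((v :: l).map (Act.tau ⬝ ·))) (by simp [Term.sum]),
        act_tau_sup_tau]
      exact sup_le hu (ih (by simp) fun w hw => h w (by simp [hw]))

lemma step_sum_tau {u : Term A} {l : List (Term A)} (h : u ∈ l) :
    Step (Term.sum (l.map (Act.tau ⬝ ·))) .tau u := by
  induction l with
  | nil => cases h
  | cons v l ih =>
    obtain rfl | h := List.mem_cons.1 h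
    · exact .addLeft _ (.pre _ _)
    · exact .addRight _ (ih h)

/-- WFE moves a stable term inside a `τ`-prefix when all its initial actions and head variables are
available there. -/
lemma cls_sup_tau {s : Term A} {q : TermQuot E} (hs : ¬ Can s .tau)
    (hstep : ∀ a, Can s (.vis a) → ∃ r, act (.vis a) r ≤ q)
    (hhead : ∀ n, Head n s → cls E (.var n) ≤ q) :
    cls E s ⊔ act .tau q = act .tau (cls E s ⊔ q) := by
  induction s generalizing q with
  | var n =>
    have := hhead n rfl
    rw [sup_eq_right.2 this, sup_eq_right.2 (this.trans (le_tau q))]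
  | nil => simp [cls_nil]
  | add t u iht ihu =>
    simp only [can_add_iff, not_or] at hs hstep
    rw [cls_add, sup_assoc, ihu hs.2 (fun a ha => hstep a (.inr ha)) fun n hn => hhead n (.inr hn),
      iht hs.1 (fun a ha => ?_) fun n hn => (hhead n (.inl hn)).trans le_sup_right, sup_assoc]
    obtain ⟨r, hr⟩ := hstep a (.inl ha)
    exact ⟨r, hr.trans le_sup_right⟩
  | pre β t =>
    cases β with
    | tau => simp at hs
    | vis a =>
      obtain ⟨r, hr⟩ := hstep a (by simp)
      have := vis_sup_tau a (cls E t) r q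
      rwa [sup_assoc, sup_eq_right.2 hr] at this

/-! ### Normal forms -/

/-- Terms without `τ`. -/
def IsStableNF : Term A → Prop
  | .var _ => True
  | .nil => True
  | .add t u => IsStableNF t ∧ IsStableNF u
  | .pre .tau _ => False
  | .pre (.vis _) t => IsStableNF t

/-- Nonempty sums of `τ`-prefixed terms without further `τ`. -/
def IsTauNF : Term A → Prop
  | .var _ => False
  | .nil => False
  | .add t u => IsTauNF t ∧ IsTauNF u
  | .pre .tau t => IsStableNF t
  | .pre (.vis _) _ => False

lemma IsStableNF.of_step {t t' : Term A} {α : Act A} (ht : IsStableNF t) (h : Step t α t') :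
    IsStableNF t' := by
  induction h with
  | pre α t =>
    cases α
    · exact ht.elim
    · exact ht
  | addLeft _ _ ih => exact ih ht.1
  | addRight _ _ ih => exact ih ht.2

lemma IsStableNF.not_can_tau {t : Term A} (ht : IsStableNF t) : ¬ Can t .tau := by
  induction t with
  | var n => simp [can_def]
  | nil => simp
  | add t u iht ihu => simpa using ⟨iht ht.1, ihu ht.2⟩
  | pre α t ih =>
    cases α
    · exact ht.elim
    · simp

lemma IsTauNF.of_step {t t' : Term A} {α : Act A} (ht : IsTauNF t) (h : Step t α t') :
    α = .tau ∧ IsStableNF t' := by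
  induction h with
  | pre α t =>
    cases α
    · exact ⟨rfl, ht⟩
    · exact ht.elim
  | addLeft _ _ ih => exact ih ht.1
  | addRight _ _ ih => exact ih ht.2

lemma IsTauNF.not_head {t : Term A} (ht : IsTauNF t) (n : ℕ) : ¬ Head n t := by
  induction t with
  | var n => exact ht.elim
  | nil => exact ht.elim
  | add t u iht ihu => exact fun h => h.elim (iht ht.1) (ihu ht.2)
  | pre α t ih => exact id

lemma IsTauNF.can_tau {t : Term A} (ht : IsTauNF t) : Can t .tau := by
  induction t with
  | var n => exact ht.elim
  | nil => exact ht.elim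
  | add t u iht ihu => exact can_add_iff.2 (.inl (iht ht.1))
  | pre α t ih =>
    cases α
    · simp
    · exact ht.elim

variable (E) in
-- WIF1 pushes the visible prefix into the sum and removes the `τ`s.
lemma IsTauNF.exists_vis {t : Term A} (ht : IsTauNF t) (a : A) :
    ∃ t', IsStableNF t' ∧ act (.vis a) (cls E t) = cls E t' := by
  induction t with
  | var n => exact ht.elim
  | nil => exact ht.elim
  | add t u iht ihu =>
    obtain ⟨t', ht', h⟩ := iht ht.1
    obtain ⟨u', hu', h'⟩ := ihu ht.2
    refine ⟨t' ∔ u', ⟨ht', hu'⟩, ?_⟩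
    rw [cls_add, cls_add, ← h, ← h', ← act_tau_sup_tau, tau_cls_eq_self ht.1.can_tau,
      tau_cls_eq_self ht.2.can_tau]
  | pre α t ih =>
    cases α
    · exact ⟨.vis a ⬝ t, ht, act_tau (.vis a) (cls E t)⟩
    · exact ht.elim

variable (E) in
-- WIF2 moves the stable summand under a `τ`, next to the body `s` of an existing `τ`-summand.
lemma IsTauNF.exists_add {t u : Term A} (ht : IsTauNF t) (hu : IsStableNF u) :
    ∃ v, IsTauNF v ∧ cls E t ⊔ cls E u = cls E v := by
  obtain ⟨s, hs⟩ := ht.can_tau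
  refine ⟨t ∔ .tau ⬝ (s ∔ u), ⟨ht, (ht.of_step hs).2, hu⟩, ?_⟩
  have hle : act .tau (cls E s) ≤ cls E t := Step.act_le hs
  rw [cls_add, cls_pre, cls_add, ← sup_eq_left.2 hle, sup_assoc, sup_assoc, tau_sup]

variable (E) in
lemma exists_normalForm (t : Term A) :
    ∃ t', (IsStableNF t' ∨ IsTauNF t') ∧ cls E t = cls E t' := by
  induction t with
  | var n => exact ⟨.var n, .inl trivial, rfl⟩
  | nil => exact ⟨.nil, .inl trivial, rfl⟩
  | add t u iht ihu =>
    obtain ⟨t', ht | ht, h⟩ := iht <;> obtain ⟨u', hu | hu, h'⟩ := ihu <;> rw [cls_add, h, h']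
    · exact ⟨t' ∔ u', .inl ⟨ht, hu⟩, rfl⟩
    · obtain ⟨v, hv, h⟩ := hu.exists_add E ht
      exact ⟨v, .inr hv, by rw [sup_comm, h]⟩
    · obtain ⟨v, hv, h⟩ := ht.exists_add E hu
      exact ⟨v, .inr hv, h⟩
    · exact ⟨t' ∔ u', .inr ⟨ht, hu⟩, rfl⟩
  | pre α t ih =>
    obtain ⟨t', ht | ht, h⟩ := ih <;> rw [cls_pre, h] <;> cases α with
    | tau => first
      | exact ⟨.tau ⬝ t', .inr ht, rfl⟩
      | exact ⟨t', .inr ht, tau_cls_eq_self ht.can_tau⟩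
    | vis a => first
      | exact ⟨.vis a ⬝ t', .inl ht, rfl⟩
      | exact (ht.exists_vis E a).imp fun v hv => ⟨.inl hv.1, hv.2⟩

/-! ### Completeness -/

/-- If every visible action is an initial action of `t`, then `τ(t + u)` absorbs `τt`. -/
def AbsorbsFull (E : Axiomatization A) : Prop :=
  ∀ t u : Term A, (∀ a, Can t (.vis a)) →
    Derives E (.tau ⬝ t ∔ .tau ⬝ (t ∔ u)) (.tau ⬝ (t ∔ u))

/-- The list consists of all `u'` with `u ⇒ -a→ u'`; summing their `τ`-prefixes gives one term with
every continuation of `u` after `a`. Stability of `t'` ensures that `u` has such a derivative. -/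
lemma Sim.exists_derivative {t u t' : Term A} {a : A} (h : Sim t u) (ht : Step t (.vis a) t')
    (ht' : ¬ Can t' .tau) :
    ∃ l : List (Term A), l ≠ [] ∧ (∀ u' ∈ l, ∃ u₁, WeakTr [] u u₁ ∧ Step u₁ (.vis a) u') ∧
      Sim t' (Term.sum (l.map (Act.tau ⬝ ·))) := by
  obtain ⟨l, hl⟩ := exists_list_weak_derivatives u a
  have key : ∀ w s, WeakTr (a :: w) u s →
      l ≠ [] ∧ WeakTr w (Term.sum (l.map (Act.tau ⬝ ·))) s := by
    rintro w s ⟨u₁, u', h₁, h₂, h₃⟩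
    have hu' : u' ∈ l := (hl u').2 ⟨u₁, h₁, h₂⟩
    exact ⟨List.ne_nil_of_mem hu', WeakTr.head_tau (step_sum_tau hu') h₃⟩
  refine ⟨l, ?_, fun u' hu' => (hl u').1 hu', fun w n s hw hn => ?_, fun w s hw hs => ?_⟩
  · obtain ⟨-, s', hs'⟩ | ⟨s', hs', -⟩ := h.stable _ _ ((weakTr_nil_refl t').head_vis ht) ht'
    · exact (key _ _ hs').1
    · exact (key _ _ hs').1
  · obtain ⟨s', hs', hn'⟩ := h.head _ n s (hw.head_vis ht) hn
    exact ⟨s', (key _ _ hs').2, hn'⟩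
  · obtain ⟨hall, s', hs'⟩ | ⟨s', hs', href⟩ := h.stable _ s (hw.head_vis ht) hs
    · exact .inl ⟨hall, s', (key _ _ hs').2⟩
    · exact .inr ⟨s', (key _ _ hs').2, href⟩

/-- A class that is above the weak derivatives and variables of `u` is above `t`, if `t` is below
`u` in the preorder and the derivatives of `t` can be dealt with. -/
lemma Sim.cls_le {t u : Term A} {q : TermQuot E} (h : Sim t u) (ht : IsStableNF t)
    (hhead : ∀ n u₁, WeakTr [] u u₁ → Head n u₁ → cls E (.var n) ≤ q)
    (hstep : ∀ a u₁ u', WeakTr [] u u₁ → Step u₁ (.vis a) u' → act (.vis a) (cls E u') ≤ q)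
    (ih : ∀ α t' v, Step t α t' → Sim t' v → act .tau (cls E t') ≤ act .tau (cls E v)) :
    cls E t ≤ q := by
  refine cls_le_of_summands (fun n hn => ?_) fun α t' ht' => ?_
  · obtain ⟨u₁, hu₁, hn'⟩ := h.head [] n t (weakTr_nil_refl t) hn
    exact hhead n u₁ hu₁ hn'
  · cases α with
    | tau => exact (ht.not_can_tau ⟨t', ht'⟩).elim
    | vis a =>
      obtain ⟨l, hl, hu, hsim⟩ := h.exists_derivative ht' (ht.of_step ht').not_can_tau
      refine (act_le_act (ih _ t' _ ht' hsim) _).trans (act_sum_tau_le hl fun u' hu' => ?_)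
      obtain ⟨u₁, h₁, h₂⟩ := hu u' hu'
      exact hstep a u₁ u' h₁ h₂

/-- By `tau_sup_le`, it suffices that `τu` absorbs `t` and that `τt` lies below some `τ(p + t)` with
`τp` below `τu`. For `p`, take a stable state of `u` refining `t`, or `u` itself when `t` offers
every action. -/
lemma Sim.tau_le (hfull : AbsorbsFull E) {t u : Term A} (h : Sim t u) (ht : IsStableNF t) :
    act .tau (cls E t) ≤ act .tau (cls E u) := by
  induction hn : sizeOf t using Nat.strong_induction_on generalizing t u with | _ n ih
  subst hn
  have hle : cls E t ≤ act .tau (cls E u) := by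
    refine h.cls_le ht (fun n u₁ h₁ h₂ => h₂.cls_le.trans (cls_le_tau_of_weakTr h₁))
      (fun a u₁ u' h₁ h₂ => h₂.act_le.trans (cls_le_tau_of_weakTr h₁)) fun α t' v ht' hv => ?_
    exact ih _ ht'.sizeOf_lt hv (ht.of_step ht') rfl
  obtain ⟨hall, -⟩ | ⟨s, hs, href⟩ := h.stable [] t (weakTr_nil_refl t) ht.not_can_tau
  · have h₁ : act .tau (cls E t) ≤ act .tau (cls E t ⊔ cls E u) :=
      sup_eq_right.1 (cls_eq_iff.2 (hfull t u hall))
    rw [sup_comm] at h₁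
    exact h₁.trans (tau_sup_le le_rfl hle)
  · have h₁ := cls_sup_tau (E := E) (q := cls E t) href.stable
      (fun a ha => (href.can a ha).elim fun r hr => ⟨cls E r, Step.act_le hr⟩)
      fun n hn => (href.head n hn).cls_le
    exact le_sup_right.trans (h₁.le.trans (tau_sup_le (tau_cls_le_of_weakTr hs) hle))

lemma Sim.cls_le_of_isTauNF (hfull : AbsorbsFull E) {t u : Term A} (h : Sim t u)
    (ht : IsTauNF t) (hu : Can u .tau) : cls E t ≤ cls E u := by
  refine cls_le_of_summands (fun n hn => (ht.not_head n hn).elim) fun α t' ht' => ?_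
  obtain ⟨rfl, hs⟩ := ht.of_step ht'
  rw [← tau_cls_eq_self hu]
  exact (h.of_tau ht').tau_le hfull hs

/-- As `u` is stable, its weak moves start at `u` itself, so the bound improves from `τu` to `u`. -/
lemma Sim.cls_le_of_isStableNF (hfull : AbsorbsFull E) {t u : Term A} (h : Sim t u)
    (ht : IsStableNF t) (hu : ¬ Can u .tau) : cls E t ≤ cls E u := by
  have hrefl : ∀ u₁, WeakTr [] u u₁ → u = u₁ := by
    intro u₁ h₁
    obtain ⟨-, rfl⟩ | ⟨t', ht', -⟩ | ⟨a, v, t', h', -⟩ := weakTr_cases h₁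
    · rfl
    · exact (hu ⟨t', ht'⟩).elim
    · cases h'
  refine h.cls_le ht (fun n u₁ h₁ h₂ => ?_) (fun a u₁ u' h₁ h₂ => ?_)
    fun α t' v ht' hv => hv.tau_le hfull (ht.of_step ht')
  · rw [hrefl u₁ h₁]
    exact h₂.cls_le
  · rw [hrefl u₁ h₁]
    exact h₂.act_le

lemma can_subst_nil_iff {t : Term A} {α : Act A} :
    Can (t.subst fun _ => .nil) α ↔ Can t α := by
  constructor
  · rintro ⟨s, hs⟩
    obtain ⟨t', ht', -⟩ | ⟨n, -, hn⟩ := step_subst_cases hs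
    · exact ⟨t', ht'⟩
    · cases hn
  · exact fun ⟨t', ht'⟩ => ⟨_, ht'.subst _⟩

/-- Terms with equivalent closed instances are provably equal. -/
theorem derives_of_forall_wf [Nonempty A] (hfull : AbsorbsFull E) {t u : Term A}
    (h : ∀ ρ, ClosedSubst ρ → WF (t.subst ρ) (u.subst ρ)) : Derives E t u := by
  -- Normal forms are taken in `axWFE A`, whose soundness transfers the hypothesis to them; nothing
  -- is assumed about soundness of `E`.
  have : Fact (axWFE A ⊆ axWFE A) := ⟨subset_rfl⟩
  obtain ⟨t', ht', hdt⟩ := exists_normalForm (axWFE A) t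
  obtain ⟨u', hu', hdu⟩ := exists_normalForm (axWFE A) u
  rw [cls_eq_iff] at hdt hdu
  have h' : ∀ ρ, ClosedSubst ρ → WF (t'.subst ρ) (u'.subst ρ) := by
    intro ρ hρ
    have h₁ := h ρ hρ
    have h₂ := wf_of_derives hdt ρ
    have h₃ := wf_of_derives hdu ρ
    rw [wf_iff] at *
    exact ⟨fun w B => (h₂.1 w B).symm.trans ((h₁.1 w B).trans (h₃.1 w B)),
      h₂.2.symm.trans (h₁.2.trans h₃.2)⟩
  have htu : Sim t' u' := sim_of_wfPreorder fun ρ hρ => (h' ρ hρ).1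
  have hut : Sim u' t' := sim_of_wfPreorder fun ρ hρ => (h' ρ hρ).2
  have hcan : Can t' .tau ↔ Can u' .tau := by
    simpa only [can_subst_nil_iff] using (wf_iff.1 (h' (fun _ => .nil) fun _ => rfl)).2
  refine ((hdt.mono hE.out).trans ?_).trans (hdu.mono hE.out).symm
  rw [← cls_eq_iff]
  obtain ht' | ht' := ht' <;> obtain hu' | hu' := hu'
  · exact le_antisymm (htu.cls_le_of_isStableNF hfull ht' hu'.not_can_tau)
      (hut.cls_le_of_isStableNF hfull hu' ht'.not_can_tau)
  · exact (ht'.not_can_tau (hcan.2 hu'.can_tau)).elim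
  · exact (hu'.not_can_tau (hcan.1 ht'.can_tau)).elim
  · exact le_antisymm (htu.cls_le_of_isTauNF hfull ht' hu'.can_tau)
      (hut.cls_le_of_isTauNF hfull hu' ht'.can_tau)

/-! ### The equation FE3' -/

lemma cls_le_cls_sum {t : Term A} {l : List (Term A)} (h : t ∈ l) :
    cls E t ≤ cls E (Term.sum l) := by
  induction l with
  | nil => cases h
  | cons u l ih =>
    obtain rfl | h := List.mem_cons.1 h
    · exact cls_le_add_left _ _
    · exact (ih h).trans (cls_le_add_right _ _)

lemma cls_sum_le {q : TermQuot E} {l : List (Term A)} (h : ∀ t ∈ l, cls E t ≤ q) :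
    cls E (Term.sum l) ≤ q := by
  induction l with
  | nil => exact bot_le
  | cons u l ih => exact sup_le (h u (by simp)) (ih fun t ht => h t (by simp [ht]))

/-- Closed instances of FE3' are derivable without it. -/
lemma tau_le_tau_sup_of_isClosed {u : Term A} (hu : u.IsClosed) {q : TermQuot E}
    (hq : ∀ a, ∃ r, act (.vis a) r ≤ q) : act .tau q ≤ act .tau (q ⊔ cls E u) := by
  induction u generalizing q with
  | var n => exact (Set.singleton_ne_empty n hu).elim
  | nil => simp [cls_nil]
  | add t u iht ihu =>
    obtain ⟨ht, hu⟩ := Set.union_empty_iff.1 hu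
    rw [cls_add, ← sup_assoc]
    refine (iht ht hq).trans (ihu hu fun a => ?_)
    exact (hq a).imp fun r hr => hr.trans le_sup_left
  | pre α u ih =>
    cases α with
    | tau =>
      -- `τ(q + τu)` equals `q + τu`, and by WIF2 this is `τu + τ(q + u)`, so the induction
      -- hypothesis for `u` applies.
      rw [cls_pre, tau_eq_self (p := cls E u) le_sup_right, sup_comm, tau_sup, sup_comm (cls E u)]
      exact (ih hu hq).trans le_sup_right
    | vis a =>
      obtain ⟨r, hr⟩ := hq a
      -- Since `q` absorbs `ar`, WFE turns `au + τq` into `τ(au + q)`.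
      have := vis_sup_tau a (cls E u) r q
      rw [sup_assoc, sup_eq_right.2 hr] at this
      rw [cls_pre, sup_comm, ← this]
      exact le_sup_right

end Completeness

lemma subst_subst (σ ρ : ℕ → Term A) (t : Term A) :
    (t.subst σ).subst ρ = t.subst fun n => (σ n).subst ρ := by
  induction t with
  | var n => rfl
  | nil => rfl
  | add t u iht ihu => exact congrArg₂ Term.add iht ihu
  | pre α t ih => exact congrArg (Term.pre α) ih

lemma subst_of_isClosed (σ : ℕ → Term A) {t : Term A} (ht : t.IsClosed) : t.subst σ = t := by
  induction t with
  | var n => exact (Set.singleton_ne_empty n ht).elim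
  | nil => rfl
  | add t u iht ihu =>
    obtain ⟨ht, hu⟩ := Set.union_empty_iff.1 ht
    exact congrArg₂ Term.add (iht ht) (ihu hu)
  | pre α t ih => exact congrArg (Term.pre α) (ih ht)

lemma isClosed_subst {ρ : ℕ → Term A} (hρ : ClosedSubst ρ) (t : Term A) :
    (t.subst ρ).IsClosed := by
  induction t with
  | var n => exact hρ n
  | nil => rfl
  | add t u iht ihu => exact Set.union_empty_iff.2 ⟨iht, ihu⟩
  | pre α t ih => exact ih

lemma subst_sum (σ : ℕ → Term A) (l : List (Term A)) :
    (Term.sum l).subst σ = Term.sum (l.map (Term.subst σ)) := by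
  induction l with
  | nil => rfl
  | cons t l ih => exact congrArg (Term.add _) ih

lemma subst_sumPre [Fintype A] (σ : ℕ → Term A) :
    (sumPre A).subst σ = Term.sum ((Finset.univ : Finset A).toList.map
      fun b => Act.vis b ⬝ σ (2 + (Fintype.equivFin A b : ℕ))) := by
  rw [sumPre, subst_sum, List.map_map]
  rfl

/-- Instantiating a whole derivation makes each use of FE3' a closed instance, which
`tau_le_tau_sup_of_isClosed` derives. -/
lemma derives_axWFE_of_closedSubst [Fintype A] {t u : Term A}
    (h : Derives (axWFE A ∪ FE3' A) t u) {ρ : ℕ → Term A} (hρ : ClosedSubst ρ) :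
    Derives (axWFE A) (t.subst ρ) (u.subst ρ) := by
  induction h with
  | @ax t u σ h =>
    rw [subst_subst, subst_subst]
    obtain h | h := h
    · exact .ax _ h
    · have : Fact (axWFE A ⊆ axWFE A) := ⟨subset_rfl⟩
      cases h
      set σ' : ℕ → Term A := fun n => (σ n).subst ρ
      have hq : ∀ a, ∃ r, act (.vis a) r ≤
          cls (axWFE A) (σ' 0) ⊔ cls (axWFE A) ((sumPre A).subst σ') := by
        intro a
        refine ⟨cls _ (σ' (2 + (Fintype.equivFin A a : ℕ))), le_trans ?_ le_sup_right⟩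
        rw [subst_sumPre]
        exact cls_le_cls_sum (List.mem_map.2 ⟨a, by simp, rfl⟩)
      have := sup_eq_right.2 (tau_le_tau_sup_of_isClosed (isClosed_subst hρ (σ 1)) hq)
      rw [sup_right_comm] at this
      exact cls_eq_iff.1 this
  | refl t => exact .refl _
  | symm _ ih => exact ih.symm
  | trans _ _ ih₁ ih₂ => exact ih₁.trans ih₂
  | pre α _ ih => exact ih.pre α
  | add _ _ ih₁ ih₂ => exact ih₁.add ih₂

lemma absorbsFull_of_infinite [Infinite A] (E : Axiomatization A) : AbsorbsFull E := fun t _ h =>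
  (Set.infinite_univ (by simpa [h] using finite_can_vis t)).elim

lemma absorbsFull_union_FE3' [Fintype A] : AbsorbsFull (axWFE A ∪ FE3' A) := by
  intro t u h
  have : Fact (axWFE A ⊆ axWFE A ∪ FE3' A) := ⟨Set.subset_union_left⟩
  choose r hr using h
  -- The variable `z_b` has index two plus the number of `b`; it is sent to a `b`-derivative of `t`,
  -- so that `t` absorbs the sum in FE3'. Later variables do not occur there, and `nil` is an
  -- arbitrary value.
  let σ : ℕ → Term A
    | 0 => t
    | 1 => u
    | n + 2 => if hn : n < Fintype.card A then r ((Fintype.equivFin A).symm ⟨n, hn⟩) else .nil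
  have hσ : ∀ b, σ (2 + (Fintype.equivFin A b : ℕ)) = r b := by
    intro b
    rw [add_comm]
    simp [σ]
  have hle : cls (axWFE A ∪ FE3' A) ((sumPre A).subst σ) ≤ cls _ t := by
    rw [subst_sumPre]
    refine cls_sum_le fun s hs => ?_
    obtain ⟨b, -, rfl⟩ := List.mem_map.1 hs
    rw [hσ]
    exact Step.act_le (hr b)
  have key : act .tau (cls (axWFE A ∪ FE3' A) t ⊔ cls _ ((sumPre A).subst σ)) ⊔
      act .tau (cls _ t ⊔ cls _ u ⊔ cls _ ((sumPre A).subst σ)) =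
      act .tau (cls _ t ⊔ cls _ u ⊔ cls _ ((sumPre A).subst σ)) :=
    cls_eq_iff.2 (.ax σ (Set.mem_union_right (axWFE A) (Set.mem_singleton _)))
  rw [sup_eq_left.2 hle, sup_eq_left.2 (hle.trans le_sup_left)] at key
  exact cls_eq_iff.1 key

/-! ### Soundness, ground-completeness and ω-completeness -/

lemma sound_axWFE : Sound (axWFE A) WF := fun _ _ h ρ _ => wf_of_derives h ρ

lemma sound_axWFE_union_FE3' [Fintype A] : Sound (axWFE A ∪ FE3' A) WF := by
  intro t u h ρ hρ
  have := wf_of_derives (derives_axWFE_of_closedSubst h hρ) ρ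
  rwa [subst_of_isClosed ρ (isClosed_subst hρ t), subst_of_isClosed ρ (isClosed_subst hρ u)] at this

lemma groundComplete_of_absorbsFull [Nonempty A] [Fact (axWFE A ⊆ E)] (hfull : AbsorbsFull E) :
    GroundComplete E WF := by
  intro p q hp hq h
  refine derives_of_forall_wf hfull fun ρ _ => ?_
  rwa [subst_of_isClosed ρ hp, subst_of_isClosed ρ hq]

lemma omegaComplete_of_absorbsFull [Nonempty A] [Fact (axWFE A ⊆ E)] (hE : Sound E WF)
    (hfull : AbsorbsFull E) : OmegaComplete E := by
  intro t u h
  refine derives_of_forall_wf hfull fun ρ hρ => ?_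
  have := hE _ _ (h ρ hρ) ρ hρ
  rwa [subst_of_isClosed ρ (isClosed_subst hρ t), subst_of_isClosed ρ (isClosed_subst hρ u)] at this

lemma groundComplete_axWFE [Nonempty A] : GroundComplete (axWFE A) WF := by
  cases finite_or_infinite A
  · have := Fintype.ofFinite A
    have : Fact (axWFE A ⊆ axWFE A ∪ FE3' A) := ⟨Set.subset_union_left⟩
    intro p q hp hq h
    -- A derivation using FE3' exists; instantiating all its variables by `nil` eliminates FE3' and
    -- leaves the closed terms `p` and `q` unchanged.
    have := derives_axWFE_of_closedSubst (ρ := fun _ => .nil)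
      (groundComplete_of_absorbsFull absorbsFull_union_FE3' p q hp hq h) fun _ => rfl
    rwa [subst_of_isClosed _ hp, subst_of_isClosed _ hq] at this
  · have : Fact (axWFE A ⊆ axWFE A) := ⟨subset_rfl⟩
    exact groundComplete_of_absorbsFull (absorbsFull_of_infinite _)


end BCCS

theorem mainTheorem12 (A : Type*) [Nonempty A] [Countable A] :
    (BCCS.Sound (BCCS.axWFE A) BCCS.WF ∧ BCCS.GroundComplete (BCCS.axWFE A) BCCS.WF) ∧
    (Infinite A → BCCS.OmegaComplete (BCCS.axWFE A)) ∧
    (∀ _ : Fintype A,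
      BCCS.Sound (BCCS.axWFE A ∪ BCCS.FE3' A) BCCS.WF ∧
      BCCS.GroundComplete (BCCS.axWFE A ∪ BCCS.FE3' A) BCCS.WF ∧
      BCCS.OmegaComplete (BCCS.axWFE A ∪ BCCS.FE3' A)) := by
  refine ⟨⟨BCCS.sound_axWFE, BCCS.groundComplete_axWFE⟩, fun _ => ?_, fun _ => ?_⟩
  · have : Fact (BCCS.axWFE A ⊆ BCCS.axWFE A) := ⟨subset_rfl⟩
    exact BCCS.omegaComplete_of_absorbsFull BCCS.sound_axWFE (BCCS.absorbsFull_of_infinite _)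
  · have : Fact (BCCS.axWFE A ⊆ BCCS.axWFE A ∪ BCCS.FE3' A) := ⟨Set.subset_union_left⟩
    exact ⟨BCCS.sound_axWFE_union_FE3',
      BCCS.groundComplete_of_absorbsFull BCCS.absorbsFull_union_FE3',
      BCCS.omegaComplete_of_absorbsFull BCCS.sound_axWFE_union_FE3' BCCS.absorbsFull_union_FE3'⟩
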